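/- For real $t$ let $\{t\}_2\in\,]-1,1]$ denote the unique number with $t-\{t\}_2\in 2\mathbb Z$, and define $U:\,]-1,1]\to\,]-1,1]$ by $U(0)=0$ and $U(x)=\{-1/x\}_2$ for $x\neq 0$. Identify $]-1,1]$ with $\mathbb R/2\mathbb Z$, also topologically. Call a function $\varphi:\,]-1,1]\to\mathbb C$ pseudo-continuous if it is bounded on $]-1,1]$ and continuous on some open set $E\subset\,]-1,1]$ with countable complement. For $\lambda\in\mathbb C$, a bounded complex Borel measure $\nu$ on $]-1,1]$ is called $(U,\lambda)$-invariant if $$\int_{]-1,1]}\varphi(U(x))\,d\nu(x)=\lambda\int_{]-1,1]}\varphi(x)\,d\nu(x)$$ for every pseudo-continuous function $\varphi$. Suppose that $\lambda\in\mathbb C$ has $|\lambda|=1$ and that $\nu$ is a bounded complex Borel measure on $]-1,1]$ which is absolutely continuous with respect to Lebesgue measure and $(U,\lambda)$-invariant. Then $\nu=0$. -/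

import Mathlib

open MeasureTheory
open scoped Topology

noncomputable section

namespace GaussType

/-- The half-open interval `]-1, 1]`, with the Borel sets that it inherits from `ℝ`. -/
abbrev J : Type := Set.Ioc (-1 : ℝ) 1

/-- Lebesgue measure on `]-1, 1]`. -/
def lebesgue : Measure J :=
  Measure.comap Subtype.val (volume : Measure ℝ)

/-- The topology of `ℝ / 2ℤ` on `]-1, 1]`, transported along the bijection
`x ↦ x mod 2`. -/
@[reducible]
def circleTopology : TopologicalSpace J :=
  TopologicalSpace.induced (fun x : J => ((x : ℝ) : AddCircle (2 : ℝ))) inferInstance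

/-- `{t}₂`: the unique number in `]-1, 1]` that differs from `t` by an element of `2ℤ`. -/
def fracTwo (t : ℝ) : J :=
  ⟨toIocMod (two_pos : (0 : ℝ) < 2) (-1) t, by
    have h := toIocMod_mem_Ioc (two_pos : (0 : ℝ) < 2) (-1) t
    norm_num at h
    exact h⟩

/-- The Gauss-type map: `U 0 = 0` and `U x = {-1/x}₂` for `x ≠ 0`. -/
def U (x : J) : J :=
  if (x : ℝ) = 0 then ⟨0, by norm_num⟩ else fracTwo (-1 / (x : ℝ))

/-- Pseudo-continuous functions: bounded, and continuous on an open subset of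
`]-1, 1] ≅ ℝ / 2ℤ` with countable complement. -/
def PseudoContinuous (φ : J → ℂ) : Prop :=
  (∃ C : ℝ, ∀ x, ‖φ x‖ ≤ C) ∧
    ∃ E : Set J, IsOpen[circleTopology] E ∧ Eᶜ.Countable ∧
      @ContinuousOn J ℂ circleTopology inferInstance φ E

/-- The integral of a complex function against a complex measure, the pairing being the
multiplication of `ℂ`. -/
def cintegral (ν : ComplexMeasure J) (φ : J → ℂ) : ℂ :=
  ν.integral φ (ContinuousLinearMap.mul ℝ ℂ)

/-- `ν` is `(U, lam)`-invariant: `∫ φ ∘ U dν = lam ∫ φ dν` for every pseudo-continuous test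
function `φ`. -/
def IsInvariant (lam : ℂ) (ν : ComplexMeasure J) : Prop :=
  ∀ φ : J → ℂ, PseudoContinuous φ →
    cintegral ν (fun x => φ (U x)) = lam * cintegral ν φ

end GaussType

end

open scoped ENNReal
open Filter

namespace GaussType

/-! Invariance says that the push-forward of `ν` under `U` is `lam • ν`. As `‖lam‖ = 1`, the total
variation of `ν` lies below its own push-forward, and equal finite mass forces equality
(`IsInvariant.measurePreserving_variation`). It remains to see that `U` has no nonzero finite
absolutely continuous invariant measure `μ` (`eq_zero_of_measurePreserving`).

The obstruction is the density `1 / (1 - x ^ 2)`, which has infinite mass and is not increased by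
the transfer operator `L` of `U` (`transfer_invDensity_le`). Let `v` be the liminf of the iterates
`L^n 1`. Fatou gives `L v ≤ v` with `v` integrable, and `L` preserves integrals, so `L v = v` almost
everywhere. A cone of densities, stable under `L` and under liminf, makes `v` continuous and `o(1 /
(1 - |x|))` at both ends. Hence, if `v` is nonzero, `(1 - x ^ 2) * v x` attains its maximum inside;
a maximum propagates to preimages, and the preimage `1 / (2 - x)` of the rightmost maximum point
lies further right. So `v = 0` (`liminf_iterate_transfer_one`).

The cone bounds `L^n 1` on `[-r, r]` by its value at `0`, so some `U^{-n}[-r, r]` has arbitrarily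
small Lebesgue measure. By invariance and absolute continuity, `μ` vanishes on `[-r, r]`. -/

/-! ### Reduction to the total variation. -/

theorem measurable_fracTwo : Measurable fracTwo := by
  refine Measurable.subtype_mk ?_
  have h : (toIocMod (two_pos : (0 : ℝ) < 2) (-1)) =
      fun t => -1 + 2 - Int.fract ((-1 + 2 - t) / 2) * 2 :=
    funext fun t => toIocMod_eq_sub_fract_mul _ _ _
  rw [h]
  exact measurable_const.sub
    ((measurable_fract.comp ((measurable_const.sub measurable_id).div_const 2)).mul_const 2)

theorem measurable_U : Measurable U := by
  refine Measurable.ite ?_ measurable_const ?_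
  · exact measurableSet_eq_fun measurable_subtype_coe measurable_const
  · exact measurable_fracTwo.comp (measurable_const.div measurable_subtype_coe)

/-- A complex measure has finite total variation. -/
theorem isFiniteMeasure_variation {X : Type*} [MeasurableSpace X] (ν : ComplexMeasure X) :
    IsFiniteMeasure ν.variation := by
  refine isFiniteMeasure_of_le
    ((ComplexMeasure.re ν).totalVariation + (ComplexMeasure.im ν).totalVariation) ?_
  refine VectorMeasure.variation_le_of_forall_enorm_le fun s _ => ?_
  calc ‖ν s‖ₑ = ‖((ν s).re : ℂ) + (ν s).im * Complex.I‖ₑ := by rw [Complex.re_add_im]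
    _ ≤ ‖(((ν s).re : ℝ) : ℂ)‖ₑ + ‖(((ν s).im : ℝ) : ℂ) * Complex.I‖ₑ := enorm_add_le _ _
    _ = ‖(ν s).re‖ₑ + ‖(ν s).im‖ₑ := by
        rw [enorm_mul]
        simp [enorm_eq_nnnorm]
    _ ≤ _ := by
        rw [Measure.add_apply]
        exact add_le_add ((ComplexMeasure.re ν).enorm_le_totalVariation s)
          ((ComplexMeasure.im ν).enorm_le_totalVariation s)

theorem cintegral_indicator_one (ν : ComplexMeasure J) {A : Set J} (hA : MeasurableSet A) :
    cintegral ν (A.indicator fun _ => 1) = ν A := by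
  have := isFiniteMeasure_variation ν
  rw [cintegral, VectorMeasure.integral, setToFun_indicator_const _ hA (measure_ne_top _ _)]
  simp [VectorMeasure.transpose]

/-- Open subintervals of `]-1, 1[` are open arcs of the circle. -/
theorem isOpen_circle_Ioo {a b : ℝ} (ha : -1 ≤ a) (hb : b ≤ 1) :
    IsOpen[circleTopology] {x : J | a < x ∧ (x : ℝ) < b} := by
  refine isOpen_induced_iff.2
    ⟨(fun t : ℝ => (t : AddCircle (2 : ℝ))) '' Set.Ioo a b,
      QuotientAddGroup.isOpenMap_coe _ isOpen_Ioo, ?_⟩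
  ext x
  constructor
  · rintro ⟨t, ht, hxt⟩
    have h : t = x := by
      have : Fact ((0 : ℝ) < 2) := ⟨two_pos⟩
      -- Negation turns `]-1, 1]` into the fundamental domain `[-1, 1[`.
      have hinj := AddCircle.coe_eq_coe_iff_of_mem_Ico (p := (2 : ℝ)) (a := -1)
        (x := -t) (y := -(x : ℝ))
        ⟨by linarith [ht.2], by linarith [ht.1]⟩ ⟨by linarith [x.2.2], by linarith [x.2.1]⟩
      have h' := hinj.1 (by simpa using hxt)
      linarith
    rw [h] at ht
    exact ht
  · intro hx
    exact ⟨x, hx, rfl⟩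

/-- On the circle the jumps occur only at `a` and at the gluing point `1`. These half-lines form a
π-system generating the Borel sets, so they suffice as tests. -/
theorem pseudoContinuous_indicator_Iio (a : J) :
    PseudoContinuous ((Set.Iio a).indicator fun _ => 1) := by
  refine ⟨⟨1, fun x => ?_⟩, {x : J | -1 < (x : ℝ) ∧ (x : ℝ) < a} ∪ {x : J | a < x ∧ (x : ℝ) < 1},
    ?_, ?_, ?_⟩
  · by_cases hx : x ∈ Set.Iio a <;> simp [hx]
  · exact @IsOpen.union _ _ _ circleTopology (isOpen_circle_Ioo le_rfl a.2.2)
      (isOpen_circle_Ioo a.2.1.le le_rfl)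
  · refine ((Set.countable_singleton a).union
      (Set.countable_singleton (⟨1, by norm_num⟩ : J))).mono fun x hx => ?_
    by_contra hne
    simp only [Set.singleton_union, Set.mem_insert_iff, Set.mem_singleton_iff, not_or] at hne
    refine hx ?_
    rcases lt_or_gt_of_ne hne.1 with h | h
    · exact Or.inl ⟨x.2.1, h⟩
    · exact Or.inr ⟨h, lt_of_le_of_ne x.2.2 fun h1 => hne.2 (Subtype.ext h1)⟩
  · let _ : TopologicalSpace J := circleTopology
    refine ContinuousOn.union_of_isOpen ?_ ?_ (isOpen_circle_Ioo le_rfl a.2.2)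
      (isOpen_circle_Ioo a.2.1.le le_rfl)
    · refine (continuousOn_const (c := (1 : ℂ))).congr fun x hx => ?_
      exact Set.indicator_of_mem (show x ∈ Set.Iio a from hx.2) _
    · refine (continuousOn_const (c := (0 : ℂ))).congr fun x hx => ?_
      exact Set.indicator_of_notMem (show x ∉ Set.Iio a from fun h => lt_asymm h hx.1) _

theorem pseudoContinuous_one : PseudoContinuous fun _ => 1 :=
  ⟨⟨1, fun _ => by simp⟩, Set.univ, @isOpen_univ _ circleTopology, by simp,
    @continuousOn_const _ _ circleTopology _ _ _⟩

theorem IsInvariant.map_eq {lam : ℂ} {ν : ComplexMeasure J} (h : IsInvariant lam ν) :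
    ν.map U = lam • ν := by
  have key : ∀ A : Set J, MeasurableSet A → PseudoContinuous (A.indicator fun _ => 1) →
      ν.map U A = (lam • ν) A := by
    intro A hA hφ
    have h1 := h _ hφ
    have h2 : (fun x => A.indicator (fun _ => (1 : ℂ)) (U x)) =
        (U ⁻¹' A).indicator fun _ => 1 := rfl
    rw [h2, cintegral_indicator_one ν hA, cintegral_indicator_one ν (measurable_U hA)] at h1
    rw [VectorMeasure.map_apply _ measurable_U hA, h1]
    rfl
  refine VectorMeasure.ext_of_generateFrom (Set.range Set.Iio) ?_ ?_ isPiSystem_Iio ?_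
  · rintro _ ⟨a, rfl⟩
    exact key _ measurableSet_Iio (pseudoContinuous_indicator_Iio a)
  · rw [BorelSpace.measurable_eq (α := J), borel_eq_generateFrom_Iio]
  · exact key _ MeasurableSet.univ (by simpa using pseudoContinuous_one)

/-- The total variation of an invariant measure with unimodular eigenvalue is invariant. -/
theorem IsInvariant.measurePreserving_variation {lam : ℂ} (hlam : ‖lam‖ = 1)
    {ν : ComplexMeasure J} (h : IsInvariant lam ν) :
    MeasurePreserving U ν.variation ν.variation := by
  have := isFiniteMeasure_variation ν
  refine ⟨measurable_U, ?_⟩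
  have hle : ν.variation ≤ ν.variation.map U := by
    have h1 : ‖lam‖₊ = 1 := by
      ext
      simpa using hlam
    calc ν.variation = (lam • ν).variation := by
          rw [VectorMeasure.variation_smul, h1, one_smul]
      _ = (ν.map U).variation := by rw [h.map_eq]
      _ ≤ _ := VectorMeasure.variation_map_le
  -- Between finite measures of equal total mass, an inequality is an equality.
  refine (Measure.eq_of_le_of_measure_univ_eq hle ?_).symm
  rw [Measure.map_apply measurable_U MeasurableSet.univ, Set.preimage_univ]

theorem variation_absolutelyContinuous {X : Type*} [MeasurableSpace X] {ν : ComplexMeasure X}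
    {m : Measure X} (h : VectorMeasure.AbsolutelyContinuous ν m.toENNRealVectorMeasure) :
    ν.variation ≪ m := by
  refine Measure.AbsolutelyContinuous.mk fun s hs hms => ?_
  refine (VectorMeasure.variation_apply_eq_zero hs).2 fun t hts ht => h ?_
  rw [Measure.toENNRealVectorMeasure_apply_measurable ht]
  exact measure_mono_null hts hms

/-! ### The transfer operator and the infinite invariant density. -/

/-- The inverse branches of the Gauss-type map. -/
noncomputable def branch (j : ℤ) (x : ℝ) : ℝ := -1 / (x + 2 * j)

/-- The transfer operator of the Gauss-type map, on nonnegative densities. -/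
noncomputable def transfer (f : ℝ → ℝ≥0∞) (x : ℝ) : ℝ≥0∞ :=
  ∑' j : {j : ℤ // j ≠ 0}, ENNReal.ofReal (1 / (x + 2 * (j : ℤ)) ^ 2) * f (branch j x)

theorem measurable_transfer {f : ℝ → ℝ≥0∞} (hf : Measurable f) : Measurable (transfer f) := by
  unfold transfer branch
  refine Measurable.tsum fun j => ?_
  fun_prop

theorem transfer_mono {f g : ℝ → ℝ≥0∞} {x : ℝ}
    (h : ∀ j : ℤ, j ≠ 0 → f (branch j x) ≤ g (branch j x)) :
    transfer f x ≤ transfer g x :=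
  ENNReal.tsum_le_tsum fun j => mul_le_mul_right (h j j.2) _

theorem one_lt_or_lt_neg_one {j : ℤ} (hj : j ≠ 0) {x : ℝ} (hx : x ∈ Set.Ioo (-1 : ℝ) 1) :
    (1 ≤ (j : ℝ) ∧ 1 < x + 2 * j) ∨ ((j : ℝ) ≤ -1 ∧ x + 2 * j < -1) := by
  rcases lt_or_gt_of_ne hj with h | h
  · have h1 : (j : ℝ) ≤ -1 := by exact_mod_cast Int.le_sub_one_of_lt h
    exact Or.inr ⟨h1, by linarith [hx.2]⟩
  · have h1 : (1 : ℝ) ≤ j := by exact_mod_cast h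
    exact Or.inl ⟨h1, by linarith [hx.1]⟩

theorem denom_ne_zero {j : ℤ} (hj : j ≠ 0) {x : ℝ} (hx : x ∈ Set.Ioo (-1 : ℝ) 1) :
    x + 2 * j ≠ 0 := by
  rcases one_lt_or_lt_neg_one hj hx with h | h
  · linarith [h.2]
  · linarith [h.2]

theorem branch_mem {j : ℤ} (hj : j ≠ 0) {x : ℝ} (hx : x ∈ Set.Ioo (-1 : ℝ) 1) :
    branch j x ∈ Set.Ioo (-1 : ℝ) 1 := by
  unfold branch
  rcases one_lt_or_lt_neg_one hj hx with h | h
  · have h0 : 0 < x + 2 * j := by linarith [h.2]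
    exact ⟨by rw [lt_div_iff₀ h0]; linarith [h.2], by rw [div_lt_iff₀ h0]; linarith [h.2]⟩
  · have h0 : x + 2 * j < 0 := by linarith [h.2]
    exact ⟨by rw [lt_div_iff_of_neg h0]; linarith [h.2],
      by rw [div_lt_iff_of_neg h0]; linarith [h.2]⟩

theorem branch_le {j : ℤ} (hj : j ≠ 0) {x y : ℝ} (hx : x ∈ Set.Ioo (-1 : ℝ) 1)
    (hy : y ∈ Set.Ioo (-1 : ℝ) 1) (hxy : x ≤ y) : branch j x ≤ branch j y := by
  unfold branch
  have hpos : 0 < (x + 2 * j) * (y + 2 * j) := by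
    rcases one_lt_or_lt_neg_one hj hx with h | h
    · exact mul_pos (by linarith) (by linarith)
    · rcases one_lt_or_lt_neg_one hj hy with h' | h'
      · linarith
      · exact mul_pos_of_neg_of_neg (by linarith) (by linarith)
  have e : -1 / (y + 2 * j) - -1 / (x + 2 * j) = (y - x) / ((x + 2 * j) * (y + 2 * j)) := by
    have := denom_ne_zero hj hx
    have := denom_ne_zero hj hy
    field_simp
    ring
  have : 0 ≤ (y - x) / ((x + 2 * j) * (y + 2 * j)) := div_nonneg (by linarith) hpos.le
  linarith

/-- The invariant density `1 / (1 - x ^ 2)`. -/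
noncomputable def invDensity (x : ℝ) : ℝ≥0∞ := ENNReal.ofReal (1 / (1 - x ^ 2))

theorem one_sub_sq_pos {x : ℝ} (hx : x ∈ Set.Ioo (-1 : ℝ) 1) : 0 < 1 - x ^ 2 := by
  nlinarith [mul_pos (sub_pos.2 hx.2) (sub_pos.2 hx.1)]

theorem weight_mul_invDensity {j : ℤ} (hj : j ≠ 0) {x : ℝ} (hx : x ∈ Set.Ioo (-1 : ℝ) 1) :
    ENNReal.ofReal (1 / (x + 2 * j) ^ 2) * invDensity (branch j x) =
      ENNReal.ofReal (1 / ((x + 2 * j) ^ 2 - 1)) := by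
  have h0 := denom_ne_zero hj hx
  have h1 := one_sub_sq_pos (branch_mem hj hx)
  rw [invDensity, ← ENNReal.ofReal_mul (by positivity)]
  congr 1
  rw [div_mul_div_comm, one_mul]
  congr 1
  unfold branch
  field_simp

/-- Partial fractions: `1 / (t ^ 2 - 1)` is half of `1 / (t - 1) - 1 / (t + 1)`, and `t` advances in
steps of 2. -/
theorem tsum_telescope_le {x : ℝ} (hx : x ∈ Set.Ioo (-1 : ℝ) 1) :
    ∑' n : ℕ, ENNReal.ofReal (1 / ((x + 2 * (n + 1)) ^ 2 - 1)) ≤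
      ENNReal.ofReal (1 / (2 * (x + 1))) := by
  refine ENNReal.tsum_le_of_sum_range_le fun n => ?_
  have hpos : ∀ k : ℕ, 0 < x + 2 * k + 1 := fun k => by
    have : (0 : ℝ) ≤ k := k.cast_nonneg
    linarith [hx.1]
  have hterm : ∀ k : ℕ, 1 / ((x + 2 * (k + 1)) ^ 2 - 1) =
      1 / (2 * (x + 2 * k + 1)) - 1 / (2 * (x + 2 * (k + 1 : ℕ) + 1)) := fun k => by
    have h1 := hpos k
    have h2 := hpos (k + 1)
    have e : (x + 2 * ((k : ℝ) + 1)) ^ 2 - 1 =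
      (x + 2 * k + 1) * (x + 2 * (k + 1 : ℕ) + 1) := by push_cast; ring
    rw [e]
    field_simp
    push_cast
    ring
  have hsum : ∑ k ∈ Finset.range n, 1 / ((x + 2 * ((k : ℝ) + 1)) ^ 2 - 1) =
      1 / (2 * (x + 1)) - 1 / (2 * (x + 2 * n + 1)) := by
    rw [Finset.sum_congr rfl fun k _ => hterm k,
      Finset.sum_range_sub' (fun k : ℕ => 1 / (2 * (x + 2 * (k : ℝ) + 1)))]
    simp
  rw [← ENNReal.ofReal_sum_of_nonneg, hsum]
  · refine ENNReal.ofReal_le_ofReal ?_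
    have := hpos n
    have : 0 ≤ 1 / (2 * (x + 2 * n + 1)) := by positivity
    linarith
  · intro k _
    have h1 := hpos k
    have : (0 : ℝ) ≤ k := k.cast_nonneg
    exact div_nonneg zero_le_one (by nlinarith)

/-- The branches with `j > 0` contribute at most `1 / (2 * (1 + x))`, those with `j < 0`, by
symmetry, at most `1 / (2 * (1 - x))`; these bounds add up to `1 / (1 - x ^ 2)`. -/
theorem transfer_invDensity_le {x : ℝ} (hx : x ∈ Set.Ioo (-1 : ℝ) 1) :
    transfer invDensity x ≤ invDensity x := by
  have hneg : -x ∈ Set.Ioo (-1 : ℝ) 1 := ⟨by linarith [hx.2], by linarith [hx.1]⟩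
  set g : ℤ → ℝ≥0∞ := ({0}ᶜ : Set ℤ).indicator
    fun j => ENNReal.ofReal (1 / ((x + 2 * j) ^ 2 - 1)) with hg
  have h1 : transfer invDensity x = ∑' j : ℤ, g j := by
    rw [hg, ← tsum_subtype]
    exact tsum_congr fun j => weight_mul_invDensity j.2 hx
  have h2 := (ENNReal.summable (f := fun n : ℕ => g (n + 1))).hasSum.of_add_one_of_neg_add_one
    (ENNReal.summable (f := fun n : ℕ => g (-(n + 1)))).hasSum
  rw [h1, h2.tsum_eq]
  have e0 : g 0 = 0 := by simp [hg]
  have e1 : ∀ n : ℕ, g (n + 1) = ENNReal.ofReal (1 / ((x + 2 * (n + 1)) ^ 2 - 1)) := fun n => by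
    rw [hg, Set.indicator_of_mem (by simp; omega)]
    push_cast
    rfl
  have e2 : ∀ n : ℕ, g (-(n + 1)) = ENNReal.ofReal (1 / ((-x + 2 * (n + 1)) ^ 2 - 1)) :=
    fun n => by
      rw [hg, Set.indicator_of_mem (by simp; omega)]
      push_cast
      congr 3
      ring
  simp_rw [e0, e1, e2, add_zero]
  refine (add_le_add (tsum_telescope_le hx) (tsum_telescope_le hneg)).trans ?_
  have p1 : 0 < x + 1 := by linarith [hx.1]
  have p2 : 0 < -x + 1 := by linarith [hx.2]
  rw [← ENNReal.ofReal_add (by positivity) (by positivity), invDensity]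
  refine ENNReal.ofReal_le_ofReal (le_of_eq ?_)
  have e : 1 - x ^ 2 = (x + 1) * (-x + 1) := by ring
  rw [e]
  field_simp
  ring

/-! ### The change of variables formula -/

theorem injOn_branch {j : ℤ} (hj : j ≠ 0) : Set.InjOn (branch j) (Set.Ioo (-1) 1) := by
  intro x hx y hy h
  have hx' := denom_ne_zero hj hx
  have hy' := denom_ne_zero hj hy
  unfold branch at h
  rw [div_eq_div_iff hx' hy'] at h
  linarith

theorem neg_one_div_branch (j : ℤ) (x : ℝ) : -1 / branch j x = x + 2 * j := by
  unfold branch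
  rw [div_div_eq_mul_div]
  ring

theorem fracTwo_add_two_mul (j : ℤ) {x : ℝ} (hx : x ∈ Set.Ioc (-1 : ℝ) 1) :
    fracTwo (x + 2 * j) = ⟨x, hx⟩ := by
  refine Subtype.ext ?_
  change toIocMod (two_pos : (0 : ℝ) < 2) (-1) (x + 2 * j) = x
  rw [mul_comm, ← zsmul_eq_mul, toIocMod_add_zsmul, toIocMod_eq_self]
  exact ⟨hx.1, by linarith [hx.2]⟩

theorem hasDerivAt_branch {j : ℤ} (hj : j ≠ 0) {x : ℝ} (hx : x ∈ Set.Ioo (-1 : ℝ) 1) :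
    HasDerivAt (branch j) (1 / (x + 2 * j) ^ 2) x := by
  have h := ((hasDerivAt_id x).add_const (2 * (j : ℝ))).inv (denom_ne_zero hj hx)
  have h2 := h.neg
  convert! h2 using 1
  · ext y
    simp [branch, neg_div]
  · simp [neg_div]

/-- The images of the inverse branches cover `]-1, 1]` up to a countable set. -/
theorem ae_eq_iUnion_branch_image :
    (⋃ j : {j : ℤ // j ≠ 0}, branch j '' Set.Ioo (-1) 1) =ᵐ[volume] Set.Ioc (-1 : ℝ) 1 := by
  refine Filter.EventuallyLE.antisymm (LE.le.eventuallyLE ?_) ?_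
  · exact Set.iUnion_subset fun j => by
      rintro _ ⟨x, hx, rfl⟩
      exact Set.Ioo_subset_Ioc_self (branch_mem j.2 hx)
  · refine ae_le_set.2 (Set.Countable.measure_zero ?_ _)
    refine ((Set.countable_singleton (0 : ℝ)).union
      (Set.countable_range fun k : ℤ => -1 / (2 * (k : ℝ) + 1))).mono ?_
    rintro x ⟨hx, hxn⟩
    by_contra hne
    simp only [Set.singleton_union, Set.mem_insert_iff, Set.mem_range, not_or, not_exists] at hne
    obtain ⟨h0, hodd⟩ := hne
    have hmem := (fracTwo (-1 / x)).2
    set j := toIocDiv (two_pos : (0 : ℝ) < 2) (-1) (-1 / x) with hj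
    have hy : ((fracTwo (-1 / x) : J) : ℝ) = -1 / x - 2 * j := by
      change toIocMod (two_pos : (0 : ℝ) < 2) (-1) (-1 / x) = _
      rw [toIocMod, zsmul_eq_mul, mul_comm]
    set y : ℝ := (fracTwo (-1 / x) : J).1 with hyd
    have hxy : x = -1 / (y + 2 * j) := by
      rw [hy]
      field_simp
      ring
    have hy1 : y < 1 := by
      refine lt_of_le_of_ne hmem.2 fun h => hodd j ?_
      rw [hxy, h, add_comm]
    have hj0 : j ≠ 0 := by
      intro h
      have hc : (j : ℝ) = 0 := by exact_mod_cast h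
      rw [hc, mul_zero, add_zero] at hxy
      have hy0 : y ≠ 0 := by
        rintro h'
        rw [h', div_zero] at hxy
        exact h0 hxy
      rcases lt_or_gt_of_ne hy0 with h' | h'
      · rw [hxy] at hx
        have := hx.2
        rw [div_le_iff_of_neg h'] at this
        linarith [hmem.1]
      · rw [hxy] at hx
        have := hx.1
        rw [lt_div_iff₀ h'] at this
        linarith
    exact hxn (Set.mem_iUnion.2 ⟨⟨j, hj0⟩, y, ⟨hmem.1, hy1⟩, hxy.symm⟩)

theorem pairwise_disjoint_branch_image :
    Pairwise (Function.onFun Disjoint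
      fun j : {j : ℤ // j ≠ 0} => branch j '' Set.Ioo (-1 : ℝ) 1) := by
  intro i j hij
  refine Set.disjoint_left.2 ?_
  rintro _ ⟨x, hx, rfl⟩ ⟨y, hy, hxy⟩
  have h : y + 2 * (j : ℤ) = x + 2 * (i : ℤ) := by
    rw [← neg_one_div_branch, ← neg_one_div_branch, hxy]
  refine hij (Subtype.ext ?_)
  have h1 : ((i : ℤ) : ℝ) < (j : ℤ) + 1 := by linarith [hx.1, hy.2]
  have h2 : ((j : ℤ) : ℝ) < (i : ℤ) + 1 := by linarith [hx.2, hy.1]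
  have h1' : (i : ℤ) < j + 1 := by exact_mod_cast h1
  have h2' : (j : ℤ) < i + 1 := by exact_mod_cast h2
  omega

theorem lintegral_lebesgue (f : ℝ → ℝ≥0∞) :
    ∫⁻ x : J, f x ∂lebesgue = ∫⁻ x in Set.Ioo (-1) 1, f x := by
  rw [lebesgue, lintegral_subtype_comap measurableSet_Ioc,
    Measure.restrict_congr_set Ioo_ae_eq_Ioc]

/-- Up to a null set the interval splits into the branch images. On each, substitute the branch,
which `U` inverts; its derivative is the weight in `transfer`. -/
theorem lintegral_comp_U_mul {f : ℝ → ℝ≥0∞} (hf : Measurable f) {φ : J → ℝ≥0∞}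
    (hφ : Measurable φ) :
    ∫⁻ x : J, φ (U x) * f x ∂lebesgue = ∫⁻ x : J, φ x * transfer f x ∂lebesgue := by
  have hnull : ∀ᵐ x : J ∂lebesgue, (x : ℝ) ≠ 0 := by
    rw [ae_iff, lebesgue, (MeasurableEmbedding.subtype_coe measurableSet_Ioc).comap_apply]
    refine measure_mono_null ?_ (Real.volume_singleton (a := 0))
    rintro _ ⟨x, hx, rfl⟩
    exact not_not.1 hx
  have h1 : ∫⁻ x : J, φ (U x) * f x ∂lebesgue =
      ∫⁻ x : J, (fun t : ℝ => φ (fracTwo (-1 / t)) * f t) x ∂lebesgue := by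
    refine lintegral_congr_ae ?_
    filter_upwards [hnull] with x hx
    simp [U, hx]
  have h2 : ∫⁻ x : J, φ x * transfer f x ∂lebesgue =
      ∫⁻ x : J, (fun t : ℝ => φ (fracTwo t) * transfer f t) x ∂lebesgue := by
    refine lintegral_congr fun x => ?_
    have := fracTwo_add_two_mul 0 x.2
    simp only [Int.cast_zero, mul_zero, add_zero] at this
    simp [this]
  have hmeas : ∀ j : {j : ℤ // j ≠ 0}, MeasurableSet (branch j '' Set.Ioo (-1) 1) := fun j =>
    measurableSet_Ioo.image_of_continuousOn_injOn
      (fun x hx => (hasDerivAt_branch j.2 hx).continuousAt.continuousWithinAt)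
      (injOn_branch j.2)
  rw [lintegral_lebesgue fun t => φ (fracTwo (-1 / t)) * f t, Measure.restrict_congr_set
    (Ioo_ae_eq_Ioc.trans ae_eq_iUnion_branch_image.symm),
    lintegral_iUnion hmeas pairwise_disjoint_branch_image] at h1
  rw [h1, h2, lintegral_lebesgue fun t => φ (fracTwo t) * transfer f t]
  simp_rw [transfer, ← ENNReal.tsum_mul_left]
  rw [lintegral_tsum]
  · refine tsum_congr fun j => ?_
    rw [lintegral_image_eq_lintegral_abs_deriv_mul measurableSet_Ioo
      (fun x hx => (hasDerivAt_branch j.2 hx).hasDerivWithinAt) (injOn_branch j.2)]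
    refine setLIntegral_congr_fun measurableSet_Ioo fun x hx => ?_
    have hx' := Set.Ioo_subset_Ioc_self hx
    have e := fracTwo_add_two_mul 0 hx'
    simp only [Int.cast_zero, mul_zero, add_zero] at e
    simp only [neg_one_div_branch, fracTwo_add_two_mul _ hx', e]
    rw [abs_of_nonneg (by positivity)]
    ring
  · intro j
    refine Measurable.aemeasurable ?_
    have h := hφ.comp measurable_fracTwo
    refine h.mul (Measurable.mul (by fun_prop) (hf.comp ?_))
    unfold branch
    fun_prop

theorem setLIntegral_preimage_U {f : ℝ → ℝ≥0∞} (hf : Measurable f) {A : Set J}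
    (hA : MeasurableSet A) :
    ∫⁻ x in U ⁻¹' A, f x ∂lebesgue = ∫⁻ x in A, transfer f x ∂lebesgue := by
  have h := lintegral_comp_U_mul hf (φ := A.indicator 1) (measurable_one.indicator hA)
  rw [← lintegral_indicator hA, ← lintegral_indicator (measurable_U hA)]
  convert! h using 2 <;> ext x
  · by_cases hx : U x ∈ A <;> simp [hx]
  · by_cases hx : x ∈ A <;> simp [hx]

theorem measurable_iterate_transfer {f : ℝ → ℝ≥0∞} (hf : Measurable f) (n : ℕ) :
    Measurable (transfer^[n] f) := by
  induction n with
  | zero => exact hf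
  | succ n ih =>
    rw [Function.iterate_succ_apply']
    exact measurable_transfer ih

theorem setLIntegral_preimage_iterate_U {f : ℝ → ℝ≥0∞} (hf : Measurable f) (n : ℕ) {A : Set J}
    (hA : MeasurableSet A) :
    ∫⁻ x in U^[n] ⁻¹' A, f x ∂lebesgue = ∫⁻ x in A, transfer^[n] f x ∂lebesgue := by
  induction n generalizing A with
  | zero => rfl
  | succ n ih =>
    rw [Function.iterate_succ_apply', ← setLIntegral_preimage_U (measurable_iterate_transfer hf n)
      hA, ← ih (measurable_U hA), Function.iterate_succ', Set.preimage_comp]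

theorem lintegral_transfer {f : ℝ → ℝ≥0∞} (hf : Measurable f) :
    ∫⁻ x in Set.Ioo (-1) 1, transfer f x = ∫⁻ x in Set.Ioo (-1) 1, f x := by
  have h := setLIntegral_preimage_U hf MeasurableSet.univ
  rw [Set.preimage_univ, setLIntegral_univ, setLIntegral_univ] at h
  rw [← lintegral_lebesgue, ← lintegral_lebesgue, h]

/-! ### A cone of densities preserved by the transfer operator -/

/-- `(1 - x) ^ 2 * f x` is nonincreasing on `]-1, 1[`. -/
def LeftBound (f : ℝ → ℝ≥0∞) : Prop :=
  ∀ ⦃x y : ℝ⦄, x ∈ Set.Ioo (-1 : ℝ) 1 → y ∈ Set.Ioo (-1 : ℝ) 1 → x ≤ y →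
    ENNReal.ofReal ((1 - y) ^ 2) * f y ≤ ENNReal.ofReal ((1 - x) ^ 2) * f x

/-- The cone of densities `f` on `]-1, 1[` for which `(1 - x) ^ 2 * f x` is nonincreasing and
`(1 + x) ^ 2 * f x` is nondecreasing. -/
structure InCone (f : ℝ → ℝ≥0∞) : Prop where
  left : LeftBound f
  right : LeftBound fun x => f (-x)

theorem neg_mem_Ioo {x : ℝ} (hx : x ∈ Set.Ioo (-1 : ℝ) 1) : -x ∈ Set.Ioo (-1 : ℝ) 1 :=
  ⟨by linarith [hx.2], by linarith [hx.1]⟩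

theorem InCone.comp_neg {f : ℝ → ℝ≥0∞} (hf : InCone f) : InCone fun x => f (-x) :=
  ⟨hf.right, by simpa using hf.left⟩

theorem InCone.mono {f : ℝ → ℝ≥0∞} (hf : InCone f) {x y : ℝ} (hx : x ∈ Set.Ioo (-1 : ℝ) 1)
    (hy : y ∈ Set.Ioo (-1 : ℝ) 1) (hxy : x ≤ y) :
    ENNReal.ofReal ((1 + x) ^ 2) * f x ≤ ENNReal.ofReal ((1 + y) ^ 2) * f y := by
  simpa using hf.right (neg_mem_Ioo hy) (neg_mem_Ioo hx) (neg_le_neg hxy)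

theorem leftBound_one : LeftBound 1 := by
  intro x y hx hy hxy
  simp only [Pi.one_apply, mul_one]
  exact ENNReal.ofReal_le_ofReal (pow_le_pow_left₀ (by linarith [hy.2]) (by linarith) 2)

theorem inCone_one : InCone 1 := ⟨leftBound_one, leftBound_one⟩

/-- It holds branch by branch: since `1 - branch j z = (z + 2j + 1) / (z + 2j)`, each term is the
same expression for `f` at the increasing point `branch j z`, times the square of `(1 - z) / (z + 2j
+ 1)`, whose absolute value is nonincreasing. -/
theorem LeftBound.transfer {f : ℝ → ℝ≥0∞} (hf : LeftBound f) : LeftBound (transfer f) := by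
  intro x y hx hy hxy
  unfold GaussType.transfer
  rw [← ENNReal.tsum_mul_left, ← ENNReal.tsum_mul_left]
  refine ENNReal.tsum_le_tsum fun ⟨j, hj⟩ => ?_
  have key : ∀ z ∈ Set.Ioo (-1 : ℝ) 1, ENNReal.ofReal ((1 - z) ^ 2) *
      (ENNReal.ofReal (1 / (z + 2 * j) ^ 2) * f (branch j z)) =
      ENNReal.ofReal (((1 - z) / (z + 2 * j + 1)) ^ 2) *
        (ENNReal.ofReal ((1 - branch j z) ^ 2) * f (branch j z)) := by
    intro z hz
    have h0 := denom_ne_zero hj hz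
    have h1 : z + 2 * j + 1 ≠ 0 := by
      rcases one_lt_or_lt_neg_one hj hz with h | h
      · linarith [h.2]
      · linarith [h.2]
    rw [← mul_assoc, ← mul_assoc, ← ENNReal.ofReal_mul (by positivity),
      ← ENNReal.ofReal_mul (by positivity)]
    congr 2
    unfold branch
    field_simp
    ring
  simp only
  rw [key x hx, key y hy]
  refine mul_le_mul' (ENNReal.ofReal_le_ofReal ?_)
    (hf (branch_mem hj hx) (branch_mem hj hy) (branch_le hj hx hy hxy))
  rw [sq_le_sq, abs_div, abs_div, abs_of_pos (sub_pos.2 hx.2), abs_of_pos (sub_pos.2 hy.2)]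
  rcases one_lt_or_lt_neg_one hj hx with h | h
  · rw [abs_of_pos (by linarith), abs_of_pos (by linarith)]
    exact div_le_div₀ (by linarith [hx.2]) (by linarith) (by linarith) (by linarith)
  · have hy' : y + 2 * j < -1 := by linarith [h.1, hy.2]
    rw [abs_of_neg (by linarith), abs_of_neg (by linarith),
      div_le_div_iff₀ (by linarith) (by linarith)]
    -- After cross-multiplication the difference is `(y - x) * (-2j - 2)`.
    nlinarith [mul_nonneg (sub_nonneg.2 hxy) (show (0 : ℝ) ≤ -2 * j - 2 by linarith [h.1])]

theorem transfer_comp_neg (f : ℝ → ℝ≥0∞) (x : ℝ) :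
    transfer (fun t => f (-t)) x = transfer f (-x) := by
  unfold transfer
  let e : {j : ℤ // j ≠ 0} ≃ {j : ℤ // j ≠ 0} :=
    (Equiv.neg ℤ).subtypeEquiv fun j => by simp
  rw [← e.tsum_eq]
  refine tsum_congr fun j => ?_
  have he : ((e j : ℤ) : ℝ) = -((j : ℤ) : ℝ) := by
    change ((-(j : ℤ) : ℤ) : ℝ) = _
    push_cast
    rfl
  have h1 : (x + 2 * ((e j : ℤ) : ℝ)) = -(-x + 2 * ((j : ℤ) : ℝ)) := by rw [he]; ring
  unfold branch
  rw [h1, neg_sq, div_neg]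
  simp only [neg_neg]

theorem InCone.transfer {f : ℝ → ℝ≥0∞} (hf : InCone f) : InCone (transfer f) := by
  refine ⟨hf.left.transfer, ?_⟩
  have h := hf.right.transfer
  rwa [funext (transfer_comp_neg f)] at h

theorem InCone.iterate_transfer {f : ℝ → ℝ≥0∞} (hf : InCone f) (n : ℕ) :
    InCone (GaussType.transfer^[n] f) := by
  induction n with
  | zero => exact hf
  | succ n ih =>
    rw [Function.iterate_succ_apply']
    exact ih.transfer

theorem liminf_const_mul {c : ℝ≥0∞} (hc : c ≠ ∞) (u : ℕ → ℝ≥0∞) :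
    c * liminf u atTop = liminf (fun n => c * u n) atTop :=
  Monotone.map_liminf_of_continuousAt (F := atTop) (f := fun t => c * t)
    (fun _ _ h => mul_le_mul_right h c) u (ENNReal.continuous_const_mul hc).continuousAt

theorem LeftBound.liminf {f : ℕ → ℝ → ℝ≥0∞} (hf : ∀ n, LeftBound (f n)) :
    LeftBound fun x => liminf (fun n => f n x) atTop := by
  intro x y hx hy hxy
  simp only [liminf_const_mul ENNReal.ofReal_ne_top]
  exact liminf_le_liminf (Eventually.of_forall fun n => hf n hx hy hxy)

theorem InCone.liminf {f : ℕ → ℝ → ℝ≥0∞} (hf : ∀ n, InCone (f n)) :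
    InCone fun x => liminf (fun n => f n x) atTop :=
  ⟨LeftBound.liminf fun n => (hf n).left, LeftBound.liminf fun n => (hf n).right⟩

/-- The two monotonicities trap `f y` between `f x * ((1 - x) / (1 - y)) ^ 2` and `f x * ((1 + x) /
(1 + y)) ^ 2`, in an order depending on the side of `x`. -/
theorem InCone.continuousOn {f : ℝ → ℝ≥0∞} (hf : InCone f)
    (hfin : ∀ x ∈ Set.Ioo (-1 : ℝ) 1, f x ≠ ∞) :
    ContinuousOn (fun x => (f x).toReal) (Set.Ioo (-1) 1) := by
  have hl : ∀ x ∈ Set.Ioo (-1 : ℝ) 1, ∀ y ∈ Set.Ioo (-1 : ℝ) 1, x ≤ y →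
      (1 - y) ^ 2 * (f y).toReal ≤ (1 - x) ^ 2 * (f x).toReal := fun x hx y hy hxy => by
    have h := ENNReal.toReal_mono (ENNReal.mul_ne_top ENNReal.ofReal_ne_top (hfin x hx))
      (hf.left hx hy hxy)
    rwa [ENNReal.toReal_mul, ENNReal.toReal_mul, ENNReal.toReal_ofReal (sq_nonneg _),
      ENNReal.toReal_ofReal (sq_nonneg _)] at h
  have hr : ∀ x ∈ Set.Ioo (-1 : ℝ) 1, ∀ y ∈ Set.Ioo (-1 : ℝ) 1, x ≤ y →
      (1 + x) ^ 2 * (f x).toReal ≤ (1 + y) ^ 2 * (f y).toReal := fun x hx y hy hxy => by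
    have h := ENNReal.toReal_mono (ENNReal.mul_ne_top ENNReal.ofReal_ne_top (hfin y hy))
      (hf.mono hx hy hxy)
    rwa [ENNReal.toReal_mul, ENNReal.toReal_mul, ENNReal.toReal_ofReal (sq_nonneg _),
      ENNReal.toReal_ofReal (sq_nonneg _)] at h
  intro x hx
  refine ContinuousAt.continuousWithinAt ?_
  have hx1 : 1 - x ≠ 0 := by linarith [hx.2]
  have hx2 : 1 + x ≠ 0 := by linarith [hx.1]
  set F := fun x => (f x).toReal
  set p : ℝ → ℝ := fun y => (1 - x) ^ 2 * F x / (1 - y) ^ 2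
  set q : ℝ → ℝ := fun y => (1 + x) ^ 2 * F x / (1 + y) ^ 2
  have hp : Tendsto p (𝓝 x) (𝓝 (F x)) := by
    have : ContinuousAt p x := by
      refine ContinuousAt.div (by fun_prop) (by fun_prop) (pow_ne_zero _ hx1)
    have e : p x = F x := by
      simp only [p]
      field_simp
    simpa [ContinuousAt, e] using this
  have hq : Tendsto q (𝓝 x) (𝓝 (F x)) := by
    have : ContinuousAt q x := by
      refine ContinuousAt.div (by fun_prop) (by fun_prop) (pow_ne_zero _ hx2)
    have e : q x = F x := by
      simp only [q]
      field_simp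
    simpa [ContinuousAt, e] using this
  have hmin := hp.min hq
  have hmax := hp.max hq
  rw [min_self] at hmin
  rw [max_self] at hmax
  refine tendsto_of_tendsto_of_tendsto_of_le_of_le' hmin hmax ?_ ?_
  all_goals
    filter_upwards [isOpen_Ioo.mem_nhds hx] with y hy
    have hy1 : 0 < (1 - y) ^ 2 := pow_pos (by linarith [hy.2]) 2
    have hy2 : 0 < (1 + y) ^ 2 := pow_pos (by linarith [hy.1]) 2
    rcases le_total x y with hxy | hxy
  · exact min_le_of_right_le (by
      rw [div_le_iff₀' hy2]; exact hr x hx y hy hxy)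
  · exact min_le_of_left_le (by
      rw [div_le_iff₀' hy1]; exact hl y hy x hx hxy)
  · exact le_max_of_le_left (by
      rw [le_div_iff₀' hy1]; exact hl x hx y hy hxy)
  · exact le_max_of_le_right (by
      rw [le_div_iff₀' hy2]; exact hr y hy x hx hxy)

/-- An integrable density in the cone is `o(1 / (1 - x))` at the right end point. -/
theorem InCone.exists_lt_of_lintegral_ne_top {f : ℝ → ℝ≥0∞} (hf : InCone f)
    (hint : ∫⁻ x in Set.Ioo (-1) 1, f x ≠ ∞) {ε : ℝ≥0∞} (hε : ε ≠ 0) :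
    ∃ r : ℝ, 0 ≤ r ∧ r < 1 ∧ ∀ x, r < x → x < 1 → ENNReal.ofReal (1 - x) * f x < 4 * ε := by
  obtain ⟨δ, hδ, h⟩ := exists_pos_setLIntegral_lt_of_measure_lt hint hε
  obtain ⟨d, hd0, hdδ⟩ := ENNReal.lt_iff_exists_real_btwn.1 hδ
  have hd : 0 < d := ENNReal.ofReal_pos.1 hdδ.1
  refine ⟨max 0 (1 - d), le_max_left _ _, by simp [hd], fun x hx hx1 => ?_⟩
  have hx0 : 0 < x := (le_max_left _ _).trans_lt hx
  have hxd : 1 - d < x := (le_max_right _ _).trans_lt hx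
  have hxm : x ∈ Set.Ioo (-1 : ℝ) 1 := ⟨by linarith, hx1⟩
  have hsub : Set.Ioo x 1 ⊆ Set.Ioo (-1 : ℝ) 1 := Set.Ioo_subset_Ioo_left (by linarith)
  have h1 := h (Set.Ioo x 1) (by
    rw [Measure.restrict_apply measurableSet_Ioo, Set.inter_eq_left.2 hsub, Real.volume_Ioo]
    exact (ENNReal.ofReal_le_ofReal (by linarith)).trans_lt hdδ.2)
  rw [Measure.restrict_restrict measurableSet_Ioo, Set.inter_eq_left.2 hsub] at h1
  -- For `0 < x < y < 1` one has `(1 + x) ^ 2 ≥ 1` and `(1 + y) ^ 2 ≤ 4`, whence the 4.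
  have hpt : ∀ y ∈ Set.Ioo x 1, f x ≤ 4 * f y := by
    intro y hy
    have hm := hf.mono hxm (hsub hy) hy.1.le
    calc f x ≤ ENNReal.ofReal ((1 + x) ^ 2) * f x := by
          refine le_mul_of_one_le_left zero_le ?_
          rw [← ENNReal.ofReal_one]
          exact ENNReal.ofReal_le_ofReal (by nlinarith)
      _ ≤ ENNReal.ofReal ((1 + y) ^ 2) * f y := hm
      _ ≤ 4 * f y := by
          refine mul_le_mul_left ?_ _
          rw [show (4 : ℝ≥0∞) = ENNReal.ofReal 4 by simp]
          exact ENNReal.ofReal_le_ofReal (by nlinarith [hy.1, hy.2])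
  calc ENNReal.ofReal (1 - x) * f x = ∫⁻ _ in Set.Ioo x 1, f x := by
        rw [setLIntegral_const, Real.volume_Ioo, mul_comm]
    _ ≤ ∫⁻ y in Set.Ioo x 1, 4 * f y := setLIntegral_mono' measurableSet_Ioo hpt
    _ = 4 * ∫⁻ y in Set.Ioo x 1, f y := lintegral_const_mul' _ _ (by simp)
    _ < 4 * ε := (ENNReal.mul_lt_mul_iff_right (by simp) (by simp)).2 h1

/-- On `[-r, r]` a density in the cone is bounded by a multiple of its value at `0`. -/
theorem InCone.le_mul_zero {f : ℝ → ℝ≥0∞} (hf : InCone f) {r x : ℝ} (hr : r < 1)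
    (hx : x ∈ Set.Icc (-r) r) : f x ≤ ENNReal.ofReal (1 / (1 - r) ^ 2) * f 0 := by
  wlog h0 : 0 ≤ x generalizing f x
  · have := this hf.comp_neg (x := -x) ⟨by linarith [hx.2], by linarith [hx.1]⟩ (by linarith)
    simpa using this
  have h := hf.left (x := 0) (y := x) (by norm_num) ⟨by linarith, by linarith [hx.2]⟩ h0
  simp only [sub_zero, one_pow, ENNReal.ofReal_one, one_mul] at h
  have hr' : 0 < 1 - r := by linarith
  calc f x = ENNReal.ofReal (1 / (1 - r) ^ 2) * (ENNReal.ofReal ((1 - r) ^ 2) * f x) := by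
        rw [← mul_assoc, ← ENNReal.ofReal_mul (by positivity), one_div_mul_cancel (by positivity),
          ENNReal.ofReal_one, one_mul]
    _ ≤ ENNReal.ofReal (1 / (1 - r) ^ 2) * (ENNReal.ofReal ((1 - x) ^ 2) * f x) := by
        refine mul_le_mul_right (mul_le_mul_left (ENNReal.ofReal_le_ofReal ?_) _) _
        exact pow_le_pow_left₀ hr'.le (by linarith [hx.2]) 2
    _ ≤ _ := mul_le_mul_right h _

/-! ### Integrable fixed points of the transfer operator in the cone vanish -/

theorem ofReal_mul_invDensity {c x : ℝ} (hc : 0 ≤ c) :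
    ENNReal.ofReal c * invDensity x = ENNReal.ofReal (c / (1 - x ^ 2)) := by
  rw [invDensity, ← ENNReal.ofReal_mul hc, mul_one_div]

/-- If a fixed point of the transfer operator, compared with the invariant density, attains its
maximum at `x`, then it also attains it at the preimage `1 / (2 - x)` of `x`. -/
theorem eq_mul_invDensity_of_fixed {f : ℝ → ℝ≥0∞} {M : ℝ≥0∞}
    (hle : ∀ y ∈ Set.Ioo (-1 : ℝ) 1, f y ≤ M * invDensity y) {x : ℝ}
    (hx : x ∈ Set.Ioo (-1 : ℝ) 1) (hfix : transfer f x = f x) (hfin : f x ≠ ∞)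
    (hmax : f x = M * invDensity x) :
    f (branch (-1) x) = M * invDensity (branch (-1) x) := by
  have hj : (-1 : ℤ) ≠ 0 := by norm_num
  by_contra hne
  have hlt := lt_of_le_of_ne (hle _ (branch_mem hj hx)) hne
  have hw : 0 < 1 / (x + 2 * ((-1 : ℤ) : ℝ)) ^ 2 :=
    one_div_pos.2 (sq_pos_of_ne_zero (denom_ne_zero hj hx))
  -- Strictness at one preimage would make the whole sum strict, so that `f x < M * invDensity x`.
  have h1 : transfer f x < transfer (fun y => M * invDensity y) x := by
    refine ENNReal.tsum_lt_tsum (i := ⟨-1, hj⟩) ?_ (fun j => ?_) ?_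
    · exact hfix.trans_ne hfin
    · exact mul_le_mul_right (hle _ (branch_mem j.2 hx)) _
    · exact (ENNReal.mul_lt_mul_iff_right (ENNReal.ofReal_pos.2 hw).ne' ENNReal.ofReal_ne_top).2 hlt
  have h2 : transfer (fun y => M * invDensity y) x = M * transfer invDensity x := by
    unfold transfer
    rw [← ENNReal.tsum_mul_left]
    exact tsum_congr fun j => mul_left_comm _ _ _
  rw [hfix, h2, hmax] at h1
  exact absurd (h1.trans_le (mul_le_mul_right (transfer_invDensity_le hx) M)) (lt_irrefl _)

theorem InCone.eq_zero_of_fixed {f : ℝ → ℝ≥0∞} (hf : InCone f)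
    (hfin : ∀ x ∈ Set.Ioo (-1 : ℝ) 1, f x ≠ ∞) (hint : ∫⁻ x in Set.Ioo (-1) 1, f x ≠ ∞)
    (hfix : ∀ x ∈ Set.Ioo (-1 : ℝ) 1, GaussType.transfer f x = f x) :
    ∀ x ∈ Set.Ioo (-1 : ℝ) 1, f x = 0 := by
  by_contra! hcon
  obtain ⟨x₁, hx₁, hne⟩ := hcon
  set u : ℝ → ℝ := fun x => (1 - x ^ 2) * (f x).toReal with hu
  have hfu : ∀ x ∈ Set.Ioo (-1 : ℝ) 1, f x = ENNReal.ofReal (u x / (1 - x ^ 2)) := by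
    intro x hx
    rw [hu, mul_div_cancel_left₀ _ (one_sub_sq_pos hx).ne', ENNReal.ofReal_toReal (hfin x hx)]
  have hc : 0 < u x₁ :=
    mul_pos (one_sub_sq_pos hx₁) (ENNReal.toReal_pos hne (hfin _ hx₁))
  have hend : ∀ g : ℝ → ℝ≥0∞, InCone g → (∀ x ∈ Set.Ioo (-1 : ℝ) 1, g x ≠ ∞) →
      ∫⁻ x in Set.Ioo (-1) 1, g x ≠ ∞ → ∃ r : ℝ, 0 ≤ r ∧ r < 1 ∧
        ∀ x, r < x → x < 1 → (1 - x ^ 2) * (g x).toReal < u x₁ := by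
    intro g hg hgfin hgint
    -- The 8 absorbs the 4 of the end point estimate and the bound `1 + x ≤ 2`.
    have hε : ENNReal.ofReal (u x₁ / 8) ≠ 0 := (ENNReal.ofReal_pos.2 (by positivity)).ne'
    obtain ⟨r, hr0, hr1, h⟩ := hg.exists_lt_of_lintegral_ne_top hgint hε
    refine ⟨r, hr0, hr1, fun x hx hx1 => ?_⟩
    have h' := h x hx hx1
    have hgx := hgfin x ⟨by linarith, hx1⟩
    rw [← ENNReal.ofReal_toReal hgx, ← ENNReal.ofReal_mul (by linarith),
      show (4 : ℝ≥0∞) = ENNReal.ofReal 4 by simp, ← ENNReal.ofReal_mul (by norm_num),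
      ENNReal.ofReal_lt_ofReal_iff (by positivity)] at h'
    have hnn : 0 ≤ (1 - x) * (g x).toReal :=
      mul_nonneg (by linarith) ENNReal.toReal_nonneg
    calc (1 - x ^ 2) * (g x).toReal = (1 + x) * ((1 - x) * (g x).toReal) := by ring
      _ ≤ 2 * ((1 - x) * (g x).toReal) := mul_le_mul_of_nonneg_right (by linarith) hnn
      _ < u x₁ := by linarith
  obtain ⟨r₁, h10, h11, hr₁⟩ := hend f hf hfin hint
  have hint' : ∫⁻ x in Set.Ioo (-1) 1, f (-x) ≠ ∞ := by
    have h := (Measure.measurePreserving_neg (volume : Measure ℝ)).setLIntegral_comp_preimage_emb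
      (Homeomorph.neg ℝ).measurableEmbedding f (Set.Ioo (-1) 1)
    have e : Neg.neg ⁻¹' Set.Ioo (-1 : ℝ) 1 = Set.Ioo (-1) 1 := by simp
    rw [e] at h
    rwa [h]
  obtain ⟨r₂, h20, h21, hr₂⟩ := hend _ hf.comp_neg (fun x hx => hfin _ (neg_mem_Ioo hx)) hint'
  set r := max r₁ (max r₂ |x₁|) with hr
  have hr1 : r < 1 := max_lt h11 (max_lt h21 (abs_lt.2 hx₁))
  have hsub : Set.Icc (-r) r ⊆ Set.Ioo (-1 : ℝ) 1 := fun x hx =>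
    ⟨by linarith [hx.1], by linarith [hx.2]⟩
  have hx₁r : x₁ ∈ Set.Icc (-r) r :=
    abs_le.1 ((le_max_right _ _).trans (le_max_right _ _))
  have hout : ∀ x ∈ Set.Ioo (-1 : ℝ) 1, x ∉ Set.Icc (-r) r → u x < u x₁ := by
    intro x hx hxr
    rcases lt_or_ge r x with h | h
    · exact hr₁ x ((le_max_left _ _).trans_lt h) hx.2
    · have h' : r < -x := by
        by_contra h''
        exact hxr ⟨by linarith, h⟩
      have := hr₂ (-x) (((le_max_left _ _).trans (le_max_right _ _)).trans_lt h')
        (by linarith [hx.1])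
      simpa [hu] using this
  have hcont : ContinuousOn u (Set.Icc (-r) r) :=
    (ContinuousOn.mul (by fun_prop) (hf.continuousOn hfin)).mono hsub
  obtain ⟨x₀, hx₀, hmax⟩ := isCompact_Icc.exists_isMaxOn ⟨x₁, hx₁r⟩ hcont
  have hmax₁ : u x₁ ≤ u x₀ := hmax hx₁r
  have hglob : ∀ y ∈ Set.Ioo (-1 : ℝ) 1, u y ≤ u x₀ := by
    intro y hy
    by_cases hyr : y ∈ Set.Icc (-r) r
    · exact hmax hyr
    · exact (hout y hy hyr).le.trans hmax₁
  have hcpt : IsCompact (Set.Icc (-r) r ∩ u ⁻¹' {u x₀}) :=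
    isCompact_Icc.of_isClosed_subset
      (hcont.preimage_isClosed_of_isClosed isClosed_Icc isClosed_singleton) Set.inter_subset_left
  -- Take the rightmost maximum point: `1 / (2 - x) > x` because `(1 - x) ^ 2 > 0`.
  obtain ⟨x, ⟨hxr, hxu⟩, hgreat⟩ := hcpt.exists_isGreatest ⟨x₀, hx₀, rfl⟩
  have hx := hsub hxr
  have hxu : u x = u x₀ := hxu
  have hpos : 0 ≤ u x₀ := hc.le.trans hmax₁
  have hj : (-1 : ℤ) ≠ 0 := by norm_num
  have hy := branch_mem hj hx
  have hyeq := eq_mul_invDensity_of_fixed (f := f) (M := ENNReal.ofReal (u x₀))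
    (fun y hy => by
      rw [ofReal_mul_invDensity hpos, hfu y hy]
      exact ENNReal.ofReal_le_ofReal
        (div_le_div_of_nonneg_right (hglob y hy) (one_sub_sq_pos hy).le))
    hx (hfix x hx) (hfin x hx) (by rw [ofReal_mul_invDensity hpos, hfu x hx, hxu])
  have hyu : u (branch (-1) x) = u x₀ := by
    rw [ofReal_mul_invDensity hpos] at hyeq
    simp only [hu] at hyeq ⊢
    rw [hyeq, ENNReal.toReal_ofReal (div_nonneg hpos (one_sub_sq_pos hy).le),
      mul_div_cancel₀ _ (one_sub_sq_pos hy).ne']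
  have hyr : branch (-1) x ∈ Set.Icc (-r) r := by
    by_contra h
    linarith [hout _ hy h]
  have hle : branch (-1) x ≤ x := hgreat ⟨hyr, hyu⟩
  have hb : branch (-1) x = 1 / (2 - x) := by
    unfold branch
    rw [← neg_div_neg_eq]
    push_cast
    ring_nf
  rw [hb, div_le_iff₀ (by linarith [hx.2])] at hle
  nlinarith [sq_pos_of_pos (sub_pos.2 hx.2)]

/-! ### Decay of the iterates of the constant density -/

theorem iterate_transfer_one_le (n : ℕ) :
    ∀ x ∈ Set.Ioo (-1 : ℝ) 1, transfer^[n] 1 x ≤ invDensity x := by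
  induction n with
  | zero =>
    intro x hx
    have h := one_sub_sq_pos hx
    rw [Function.iterate_zero, id, Pi.one_apply, invDensity, ← ENNReal.ofReal_one]
    refine ENNReal.ofReal_le_ofReal ?_
    rw [le_div_iff₀ h]
    nlinarith [sq_nonneg x]
  | succ n ih =>
    intro x hx
    rw [Function.iterate_succ_apply']
    exact (transfer_mono fun j hj => ih _ (branch_mem hj hx)).trans (transfer_invDensity_le hx)

theorem lintegral_iterate_transfer {f : ℝ → ℝ≥0∞} (hf : Measurable f) (n : ℕ) :
    ∫⁻ x in Set.Ioo (-1) 1, transfer^[n] f x = ∫⁻ x in Set.Ioo (-1) 1, f x := by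
  induction n with
  | zero => rfl
  | succ n ih =>
    rw [Function.iterate_succ_apply', lintegral_transfer (measurable_iterate_transfer hf n), ih]

/-- Fatou's lemma for the counting measure on the branches. -/
theorem transfer_liminf_le (f : ℕ → ℝ → ℝ≥0∞) (x : ℝ) :
    transfer (fun y => liminf (fun n => f n y) atTop) x ≤
      liminf (fun n => transfer (f n) x) atTop := by
  unfold transfer
  simp_rw [liminf_const_mul ENNReal.ofReal_ne_top, ← lintegral_count]
  exact lintegral_liminf_le fun n => measurable_of_countable _

theorem liminf_iterate_transfer_one {x : ℝ} (hx : x ∈ Set.Ioo (-1 : ℝ) 1) :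
    liminf (fun n => transfer^[n] 1 x) atTop = 0 := by
  set v : ℝ → ℝ≥0∞ := fun x => liminf (fun n => transfer^[n] 1 x) atTop with hv
  have hmeas : Measurable v :=
    Measurable.liminf fun n => measurable_iterate_transfer measurable_one n
  have hcone : InCone v := InCone.liminf fun n => inCone_one.iterate_transfer n
  have hfin : ∀ x ∈ Set.Ioo (-1 : ℝ) 1, v x ≠ ∞ := by
    intro x hx
    have h : v x ≤ liminf (fun _ : ℕ => invDensity x) atTop :=
      liminf_le_liminf (Eventually.of_forall fun n => iterate_transfer_one_le n x hx)
    rw [liminf_const] at h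
    exact (h.trans_lt ENNReal.ofReal_lt_top).ne
  have hint : ∫⁻ x in Set.Ioo (-1) 1, v x ≠ ∞ := by
    refine ((lintegral_liminf_le fun n =>
      measurable_iterate_transfer measurable_one n).trans_lt ?_).ne
    simp_rw [lintegral_iterate_transfer measurable_one]
    simp
  have hle : ∀ x, transfer v x ≤ v x := by
    intro x
    refine (transfer_liminf_le _ x).trans (le_of_eq ?_)
    have h : (fun n => transfer (transfer^[n] 1) x) = fun n => transfer^[n + 1] 1 x :=
      funext fun n => by rw [Function.iterate_succ_apply']
    rw [h]
    exact liminf_nat_add (fun n => transfer^[n] 1 x) 1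
  have hae : transfer v =ᵐ[volume.restrict (Set.Ioo (-1) 1)] v := by
    refine ae_eq_of_ae_le_of_lintegral_le (Eventually.of_forall hle) ?_ hmeas.aemeasurable ?_
    · rwa [lintegral_transfer hmeas]
    · rw [lintegral_transfer hmeas]
  have hfin' : ∀ x ∈ Set.Ioo (-1 : ℝ) 1, transfer v x ≠ ∞ := fun x hx =>
    ((hle x).trans_lt (hfin x hx).lt_top).ne
  -- Continuity from the cone upgrades almost everywhere to everywhere, as the maximum argument
  -- needs.
  have heq := Measure.eqOn_open_of_ae_eq (hae.fun_comp ENNReal.toReal) isOpen_Ioo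
    (hcone.transfer.continuousOn hfin') (hcone.continuousOn hfin)
  exact hcone.eq_zero_of_fixed hfin hint
    (fun x hx => (ENNReal.toReal_eq_toReal_iff' (hfin' x hx) (hfin x hx)).1 (heq hx)) x hx

/-! ### Absence of finite absolutely continuous invariant measures. -/

theorem lebesgue_univ : lebesgue Set.univ = 2 := by
  have h := lintegral_lebesgue 1
  simp only [Pi.one_apply, lintegral_one, Measure.restrict_apply_univ, Real.volume_Ioo] at h
  rw [h]
  norm_num

/-- The preimages of a compact subinterval of `]-1, 1[` under the iterates of `U` get
arbitrarily small. -/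
theorem exists_lebesgue_preimage_iterate_lt {r : ℝ} (hr1 : r < 1) {δ : ℝ≥0∞} (hδ : 0 < δ) :
    ∃ n : ℕ, lebesgue (U^[n] ⁻¹' {x : J | (x : ℝ) ∈ Set.Icc (-r) r}) < δ := by
  set K : Set J := {x : J | (x : ℝ) ∈ Set.Icc (-r) r}
  have hK : MeasurableSet K := measurable_subtype_coe measurableSet_Icc
  set c : ℝ≥0∞ := ENNReal.ofReal (1 / (1 - r) ^ 2) * 2 with hc
  have hc0 : c ≠ ∞ := ENNReal.mul_ne_top ENNReal.ofReal_ne_top (by simp)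
  have hbound : ∀ n : ℕ, lebesgue (U^[n] ⁻¹' K) ≤ c * transfer^[n] 1 0 := by
    intro n
    have h := setLIntegral_preimage_iterate_U measurable_one n hK
    simp only [Pi.one_apply, setLIntegral_one] at h
    have huniv : lebesgue K ≤ 2 := (measure_mono (Set.subset_univ K)).trans lebesgue_univ.le
    rw [h]
    calc ∫⁻ x in K, transfer^[n] 1 x ∂lebesgue
        ≤ ∫⁻ _ in K, ENNReal.ofReal (1 / (1 - r) ^ 2) * transfer^[n] 1 0 ∂lebesgue :=
          setLIntegral_mono' hK fun x hx => (inCone_one.iterate_transfer n).le_mul_zero hr1 hx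
      _ = ENNReal.ofReal (1 / (1 - r) ^ 2) * transfer^[n] 1 0 * lebesgue K :=
          setLIntegral_const _ _
      _ ≤ ENNReal.ofReal (1 / (1 - r) ^ 2) * transfer^[n] 1 0 * 2 := mul_le_mul_right huniv _
      _ = c * transfer^[n] 1 0 := by rw [hc]; ring
  have hlim : liminf (fun n => c * transfer^[n] 1 0) atTop < δ := by
    rw [← liminf_const_mul hc0, liminf_iterate_transfer_one (by norm_num), mul_zero]
    exact hδ
  obtain ⟨n, hn⟩ := (frequently_lt_of_liminf_lt (by isBoundedDefault) hlim).exists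
  exact ⟨n, (hbound n).trans_lt hn⟩

/-- The map `U` has no nonzero finite invariant measure that is absolutely continuous. -/
theorem eq_zero_of_measurePreserving {μ : Measure J} [IsFiniteMeasure μ] (hac : μ ≪ lebesgue)
    (hU : MeasurePreserving U μ μ) : μ = 0 := by
  have hfinite : IsFiniteMeasure lebesgue := ⟨by rw [lebesgue_univ]; simp⟩
  have hwd : lebesgue.withDensity (μ.rnDeriv lebesgue) = μ :=
    Measure.withDensity_rnDeriv_eq _ _ hac
  have hK : ∀ r : ℝ, r < 1 → μ {x : J | (x : ℝ) ∈ Set.Icc (-r) r} = 0 := by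
    intro r hr
    have hKm : MeasurableSet {x : J | (x : ℝ) ∈ Set.Icc (-r) r} :=
      measurable_subtype_coe measurableSet_Icc
    by_contra hne
    -- The tolerance is the measure of the interval itself, so invariance yields a quantity smaller
    -- than itself.
    obtain ⟨δ, hδ, h⟩ := exists_pos_setLIntegral_lt_of_measure_lt
      (Measure.lintegral_rnDeriv_lt_top μ lebesgue).ne hne
    obtain ⟨n, hn⟩ := exists_lebesgue_preimage_iterate_lt hr hδ
    have h1 := h _ hn
    rw [← withDensity_apply _ ((hU.iterate n).measurable hKm), hwd,
      (hU.iterate n).measure_preimage hKm.nullMeasurableSet] at h1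
    exact lt_irrefl _ h1
  have hone : μ {x : J | (x : ℝ) = 1} = 0 := by
    refine hac ?_
    rw [lebesgue, (MeasurableEmbedding.subtype_coe measurableSet_Ioc).comap_apply]
    refine measure_mono_null ?_ (Real.volume_singleton (a := 1))
    rintro _ ⟨x, hx, rfl⟩
    exact hx
  refine Measure.measure_univ_eq_zero.1 (measure_mono_null (t := {x : J | (x : ℝ) = 1} ∪
    ⋃ n : ℕ, {x : J | (x : ℝ) ∈ Set.Icc (-(1 - 1 / ((n : ℝ) + 1))) (1 - 1 / ((n : ℝ) + 1))})
    ?_ (measure_union_null hone (measure_iUnion_null fun n => hK _ ?_)))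
  · intro x _
    rcases eq_or_lt_of_le x.2.2 with h | h
    · exact Or.inl h
    · have habs : 0 < 1 - |(x : ℝ)| := sub_pos.2 (abs_lt.2 ⟨x.2.1, h⟩)
      obtain ⟨n, hn⟩ := exists_nat_one_div_lt habs
      exact Or.inr (Set.mem_iUnion.2 ⟨n, abs_le.1 (by linarith)⟩)
  · have : 0 < 1 / ((n : ℝ) + 1) := by positivity
    linarith

end GaussType

theorem mainTheorem4 (lam : ℂ) (hlam : ‖lam‖ = 1)
    (ν : MeasureTheory.ComplexMeasure GaussType.J)
    (hac : MeasureTheory.VectorMeasure.AbsolutelyContinuous ν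
      GaussType.lebesgue.toENNRealVectorMeasure)
    (hinv : GaussType.IsInvariant lam ν) :
    ν = 0 := by
  have := GaussType.isFiniteMeasure_variation ν
  exact VectorMeasure.variation_eq_zero.1 (GaussType.eq_zero_of_measurePreserving
    (GaussType.variation_absolutelyContinuous hac) (hinv.measurePreserving_variation hlam))
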